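/- Let $\{\psi_{j,k}\}$ be a bounded-bandwidth periodized wavelet basis: an orthonormal basis of $L^2([0,1])$ consisting of the periodizations $\sum_{n\in\mathbb Z}2^{j/2}\psi(2^j(t+n)-k)$, $j\ge m_0$, $0\le k<2^j$, of an integrable wavelet $\psi$, together with the analogous periodizations of an integrable scaling function at resolution $m_0$ (denoted $\psi_{m_0-1,k}$, $0\le k<2^{m_0}$), where both generating functions have compactly supported Fourier transform. Let $\{\eta_{j',k'}\}$ be a finitely supported $s_0$-regular periodized wavelet basis, i.e. an orthonormal basis of $L^2([0,1])$ built in the same way, with lowest level $m_0'$, from a wavelet and a scaling function that are compactly supported and of class $C^{s_0}$, $s_0\in\mathbb N_0$. Let $1\le p,q\le\infty$ and $s^*=s+\frac12-\frac1p$ (with $1/\infty=0$). For $A>0$ put $$B^{s_1,s_2}_{p,q}(A)=\Big\{f\in L^2([0,1]^2):\Big(\sum_{j\ge m_0-1}\sum_{j'\ge m_0'-1}2^{(js_1^*+j's_2^*)q}\Big(\sum_{k,k'}|\beta_{j,k,j',k'}|^p\Big)^{q/p}\Big)^{1/q}\le A\Big\},$$ $$B^{s}_{p,q}(A)=\Big\{g\in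 L^2([0,1]):\Big(\sum_{j\ge m_0-1}2^{js^*q}\Big(\sum_{k}|\langle g,\psi_{j,k}\rangle|^p\Big)^{q/p}\Big)^{1/q}\le A\Big\},$$ where $\beta_{j,k,j',k'}=\int_0^1\!\int_0^1 f(u,t)\,\overline{\psi_{j,k}(t)}\,\overline{\eta_{j',k'}(u)}\,dt\,du$, with suprema in place of the sums when $p$ or $q$ is $\infty$. Suppose $s_1\ge\max\{1/p,1/2\}$ and $s_2>\max\{1/p,1/2\}$. Then there is a constant $C>0$, depending only on the two bases and on $s_1,s_2,p,q$, such that for every $A>0$ and every $f\in B^{s_1,s_2}_{p,q}(A)$: $f$ has a version (a function equal to $f$ almost everywhere on $[0,1]^2$) for which $u\mapsto f(u,\cdot)$ is continuous from $[0,1]$ to $L^2([0,1])$; and for every such version and all integers $1\le l\le M$, the profile $f_l(t)=f(u_l,t)$, $u_l=l/M$, belongs to $B^{s_1}_{p,q}(\tilde A)$ with $\tilde A=CA$. -/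

import Mathlib

open MeasureTheory Set Filter Topology
open scoped ENNReal FourierTransform ComplexConjugate

noncomputable section

namespace MixedBesov

/-- Lebesgue measure on the unit interval `[0,1]`. -/
abbrev unitMeasure : Measure ℝ := volume.restrict (Icc (0 : ℝ) 1)

/-! ### Periodized wavelet bases -/

/-- The periodization `t ↦ ∑_{n ∈ ℤ} 2^{j/2} g (2^j (t + n) - k)` of the dilated and translated
function `2^{j/2} g (2^j · - k)`. -/
def periodized (g : ℝ → ℂ) (j k : ℕ) (t : ℝ) : ℂ :=
  ∑' n : ℤ, (((2 : ℝ) ^ ((j : ℝ) / 2) : ℝ) : ℂ) * g ((2 : ℝ) ^ j * (t + n) - k)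

/-- With lowest resolution level `m₀`, the resolution levels are `j = m₀ - 1, m₀, m₀ + 1, …`,
enumerated as `j = m₀ - 1 + i`, `i : ℕ`. -/
def level (m₀ i : ℕ) : ℝ := (m₀ : ℝ) - 1 + i

/-- The number of basis functions at the `i`-th level: `2^{m₀}` scaling functions for `i = 0`
(written as level `m₀ - 1`), and `2^j` wavelets at the level `j = m₀ + n` for `i = n + 1`. -/
def levelCard (m₀ : ℕ) : ℕ → ℕ
  | 0 => 2 ^ m₀
  | n + 1 => 2 ^ (m₀ + n)

/-- The functions of the periodized wavelet system generated by the scaling function `φ` and the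
wavelet `ψ`: for `i = 0` the periodized scaling functions of resolution `m₀`, for `i = n + 1` the
periodized wavelets of resolution `m₀ + n`. -/
def wavelet (m₀ : ℕ) (φ ψ : ℝ → ℂ) : ℕ → ℕ → ℝ → ℂ
  | 0, k => periodized φ m₀ k
  | n + 1, k => periodized ψ (m₀ + n) k

/-- The periodized wavelet system generated by `φ` and `ψ` from the lowest level `m₀` on is an
orthonormal basis of `L²([0,1])`. -/
def IsPeriodizedWaveletBasis (m₀ : ℕ) (φ ψ : ℝ → ℂ) : Prop :=
  ∃ b : HilbertBasis (Σ i : ℕ, Fin (levelCard m₀ i)) ℂ (Lp ℂ 2 unitMeasure),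
    ∀ (i : ℕ) (k : Fin (levelCard m₀ i)), b ⟨i, k⟩ =ᵐ[unitMeasure] wavelet m₀ φ ψ i k

/-- A periodized wavelet basis of bounded bandwidth (for example of Meyer type). -/
structure IsBandLimitedWaveletBasis (m₀ : ℕ) (φ ψ : ℝ → ℂ) : Prop where
  integrable_scaling : Integrable φ
  integrable_wavelet : Integrable ψ
  bandlimited_scaling : HasCompactSupport (𝓕 φ)
  bandlimited_wavelet : HasCompactSupport (𝓕 ψ)
  basis : IsPeriodizedWaveletBasis m₀ φ ψ

/-- A finitely supported periodized wavelet basis of regularity `s₀` (for example of Daubechies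
type): the generating functions have compact support and are of class `C^{s₀}`. -/
structure IsFinitelySupportedWaveletBasis (s₀ m₀ : ℕ) (φ ψ : ℝ → ℂ) : Prop where
  compact_scaling : HasCompactSupport φ
  compact_wavelet : HasCompactSupport ψ
  regular_scaling : ContDiff ℝ s₀ φ
  regular_wavelet : ContDiff ℝ s₀ ψ
  basis : IsPeriodizedWaveletBasis m₀ φ ψ

/-! ### Besov balls -/

/-- The `ℓ^p` norm `(∑ a_i^p)^{1/p}` of a family in `[0, ∞]`, with the supremum for `p = ∞`. -/
def lNorm {ι : Type*} (p : ℝ≥0∞) (a : ι → ℝ≥0∞) : ℝ≥0∞ :=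
  if p = ∞ then ⨆ i, a i else (∑' i, a i ^ p.toReal) ^ (1 / p.toReal)

/-- `s^* = s + 1/2 - 1/p`, where `1/∞ = 0`. -/
def sStar (s : ℝ) (p : ℝ≥0∞) : ℝ := s + 1 / 2 - (p⁻¹).toReal

/-- The wavelet coefficient `⟨g, ψ_{j,k}⟩` of a function on `[0,1]`. -/
def coeff (m₀ : ℕ) (φ ψ : ℝ → ℂ) (g : ℝ → ℂ) (i k : ℕ) : ℂ :=
  ∫ t, g t * conj (wavelet m₀ φ ψ i k t) ∂unitMeasure

/-- The hyperbolic wavelet coefficient `β_{j,k,j',k'} = ⟨⟨f(u,·), ψ_{j,k}⟩, η_{j',k'}⟩` of a function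
`f (u, t)` on `[0,1]²`. Here `(φ, ψ)` generate the basis in `t` and `(ξ, η)` the basis in `u`. -/
def coeff₂ (m₀ m₀' : ℕ) (φ ψ ξ η : ℝ → ℂ) (f : ℝ × ℝ → ℂ) (i k i' k' : ℕ) : ℂ :=
  coeff m₀' ξ η (fun u => coeff m₀ φ ψ (fun t => f (u, t)) i k) i' k'

/-- The one-dimensional Besov ball `B^s_{p,q}(A)`. -/
def ball (m₀ : ℕ) (φ ψ : ℝ → ℂ) (s : ℝ) (p q : ℝ≥0∞) (A : ℝ) : Set (ℝ → ℂ) :=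
  {g | MemLp g 2 unitMeasure ∧
    lNorm q (fun i : ℕ =>
      ENNReal.ofReal ((2 : ℝ) ^ (level m₀ i * sStar s p)) *
        lNorm p (fun k : Fin (levelCard m₀ i) => ‖coeff m₀ φ ψ g i k‖ₑ)) ≤ ENNReal.ofReal A}

/-- The Besov ball of mixed regularity `B^{s₁,s₂}_{p,q}(A)`; the smoothness is `s₁` in `t` and `s₂`
in `u`, for functions `f (u, t)`. -/
def ball₂ (m₀ m₀' : ℕ) (φ ψ ξ η : ℝ → ℂ) (s₁ s₂ : ℝ) (p q : ℝ≥0∞) (A : ℝ) : Set (ℝ × ℝ → ℂ) :=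
  {f | MemLp f 2 (unitMeasure.prod unitMeasure) ∧
    lNorm q (fun i : ℕ × ℕ =>
      ENNReal.ofReal ((2 : ℝ) ^ (level m₀ i.1 * sStar s₁ p + level m₀' i.2 * sStar s₂ p)) *
        lNorm p (fun k : Fin (levelCard m₀ i.1) × Fin (levelCard m₀' i.2) =>
          ‖coeff₂ m₀ m₀' φ ψ ξ η f i.1 k.1 i.2 k.2‖ₑ)) ≤ ENNReal.ofReal A}

/-- Elements of `L²([0,1]²)` are only defined almost everywhere, so that a single profile
`f (u, ·)` is read off the version of `f` whose profiles depend continuously on `u`: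
`g = f` almost everywhere on `[0,1]²` and `u ↦ g (u, ·)` is continuous from `[0,1]` to `L²([0,1])`.
The profiles of such a version are determined by `f` almost everywhere. -/
structure IsContinuousVersion (f g : ℝ × ℝ → ℂ) : Prop where
  ae_eq : g =ᵐ[unitMeasure.prod unitMeasure] f
  memLp : ∀ u ∈ Icc (0 : ℝ) 1, MemLp (fun t => g (u, t)) 2 unitMeasure
  continuous : ∀ u₀ ∈ Icc (0 : ℝ) 1,
    Tendsto (fun u => eLpNorm (fun t => g (u, t) - g (u₀, t)) 2 unitMeasure)
      (𝓝[Icc (0 : ℝ) 1] u₀) (𝓝 0)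

end MixedBesov

end

open MixedBesov

noncomputable section

namespace MixedBesov

/-! ### The `ℓ^p` norm -/

section lNorm

variable {ι κ : Type*} {p : ℝ≥0∞}

/-! Expand `f` in the variable `u` only: `f(u,·) = ∑ η_{j',k'}(u) B_{j',k'}`, where `B_{j',k'}` is
the sequence `(β_{j,k,j',k'})_{j,k}`, identified with an element of `L²` through the basis in `t`.
Two estimates make this series work.

The condition on `s₁` puts each `B_{j',k'}` in `ℓ²` with norm at most a constant times `A 2^{-j'
s₂^*}` (`sum_sq_level_le`, `exists_tsum_sq_le`). Since `η` is bounded with compact support, only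
boundedly many terms at a level are nonzero at a given point, so `∑_{k'} |η_{j',k'}(u)| ≤ K
2^{j'/2}` (`sum_norm_wavelet_le`). As `s₂ > 1/p` means `s₂^* > 1/2`, the series converges uniformly
in `ℓ²`, and its sum is continuous in `u`; this yields the continuous version.

For every continuous version, each coefficient of the profile is continuous in `u` and agrees almost
everywhere with the scalar series `∑ η_{j',k'}(u) β_{j,k,j',k'}`, hence agrees at every `u ∈ [0,1]`.
Minkowski's inequality in `ℓ^p` and then in `ℓ^q` bounds the Besov norm of the profile by `A ∑_{j'}
K 2^{-j'(s₂^* - 1/2)}` (`exists_lNorm_synthesis_le`), uniformly in `u`. -/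

theorem lNorm_top (a : ι → ℝ≥0∞) : lNorm ∞ a = ⨆ i, a i := by simp [lNorm]

theorem lNorm_of_ne_top (hp : p ≠ ∞) (a : ι → ℝ≥0∞) :
    lNorm p a = (∑' i, a i ^ p.toReal) ^ (1 / p.toReal) := by simp [lNorm, hp]

theorem one_le_toReal (hp : 1 ≤ p) (h : p ≠ ∞) : 1 ≤ p.toReal := by
  simpa using (ENNReal.toReal_le_toReal ENNReal.one_ne_top h).2 hp

theorem lNorm_mono {a b : ι → ℝ≥0∞} (h : ∀ i, a i ≤ b i) : lNorm p a ≤ lNorm p b := by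
  by_cases hp : p = ∞
  · subst hp
    simpa only [lNorm_top] using iSup_mono h
  · rw [lNorm_of_ne_top hp, lNorm_of_ne_top hp]
    have : 0 ≤ p.toReal := ENNReal.toReal_nonneg
    exact ENNReal.rpow_le_rpow
      (ENNReal.tsum_le_tsum fun i => ENNReal.rpow_le_rpow (h i) this) (by positivity)

theorem le_lNorm (hp : 1 ≤ p) (a : ι → ℝ≥0∞) (i : ι) : a i ≤ lNorm p a := by
  by_cases h : p = ∞
  · subst h
    simpa only [lNorm_top] using le_iSup a i
  · have h1 := one_le_toReal hp h
    rw [lNorm_of_ne_top h, one_div, ENNReal.le_rpow_inv_iff (by positivity)]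
    exact ENNReal.le_tsum i

theorem lNorm_comp_le {e : κ → ι} (he : Function.Injective e) (a : ι → ℝ≥0∞) :
    lNorm p (fun i => a (e i)) ≤ lNorm p a := by
  by_cases h : p = ∞
  · subst h
    simpa only [lNorm_top] using iSup_comp_le a e
  · rw [lNorm_of_ne_top h, lNorm_of_ne_top h]
    have : 0 ≤ p.toReal := ENNReal.toReal_nonneg
    exact ENNReal.rpow_le_rpow
      (ENNReal.tsum_comp_le_tsum_of_injective he fun i => a i ^ p.toReal) (by positivity)

theorem lNorm_const_mul (hp : 1 ≤ p) (c : ℝ≥0∞) (a : ι → ℝ≥0∞) :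
    lNorm p (fun i => c * a i) = c * lNorm p a := by
  by_cases h : p = ∞
  · subst h
    simp only [lNorm_top, ENNReal.mul_iSup]
  · have h1 := one_le_toReal hp h
    have h0 : p.toReal ≠ 0 := by positivity
    rw [lNorm_of_ne_top h, lNorm_of_ne_top h]
    simp_rw [ENNReal.mul_rpow_of_nonneg _ _ (zero_le_one.trans h1)]
    rw [ENNReal.tsum_mul_left, ENNReal.mul_rpow_of_nonneg _ _ (by positivity),
      ← ENNReal.rpow_mul, mul_one_div_cancel h0, ENNReal.rpow_one]

theorem sum_rpow_rpow_le_lNorm (h : p ≠ ∞) (a : ι → ℝ≥0∞) (s : Finset ι) :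
    (∑ i ∈ s, a i ^ p.toReal) ^ (1 / p.toReal) ≤ lNorm p a := by
  rw [lNorm_of_ne_top h]
  have : 0 ≤ p.toReal := ENNReal.toReal_nonneg
  exact ENNReal.rpow_le_rpow (ENNReal.sum_le_tsum s) (by positivity)

theorem lNorm_le_of_sum_rpow_rpow_le (hp : 1 ≤ p) (h : p ≠ ∞) {a : ι → ℝ≥0∞} {c : ℝ≥0∞}
    (H : ∀ s : Finset ι, (∑ i ∈ s, a i ^ p.toReal) ^ (1 / p.toReal) ≤ c) : lNorm p a ≤ c := by
  have h1 := one_le_toReal hp h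
  rw [lNorm_of_ne_top h, one_div, ENNReal.rpow_inv_le_iff (by positivity)]
  rw [ENNReal.tsum_eq_iSup_sum]
  refine iSup_le fun s => ?_
  rw [← ENNReal.rpow_inv_le_iff (by positivity), ← one_div]
  exact H s

theorem lNorm_add_le (hp : 1 ≤ p) (a b : ι → ℝ≥0∞) :
    lNorm p (fun i => a i + b i) ≤ lNorm p a + lNorm p b := by
  by_cases h : p = ∞
  · subst h
    simp only [lNorm_top]
    exact iSup_le fun i => add_le_add (le_iSup a i) (le_iSup b i)
  · refine lNorm_le_of_sum_rpow_rpow_le hp h fun s => ?_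
    exact (ENNReal.Lp_add_le s a b (one_le_toReal hp h)).trans
      (add_le_add (sum_rpow_rpow_le_lNorm h a s) (sum_rpow_rpow_le_lNorm h b s))

theorem lNorm_zero (hp : 1 ≤ p) : lNorm p (fun _ : ι => 0) = 0 := by
  simpa using lNorm_const_mul (ι := ι) hp 0 (fun _ => 0)

theorem lNorm_sum_le (hp : 1 ≤ p) (a : κ → ι → ℝ≥0∞) (s : Finset κ) :
    lNorm p (fun i => ∑ n ∈ s, a n i) ≤ ∑ n ∈ s, lNorm p (a n) := by
  classical
  induction s using Finset.induction_on with
  | empty => simp [lNorm_zero hp]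
  | insert n s hn ih =>
    simp only [Finset.sum_insert hn]
    exact (lNorm_add_le hp _ _).trans (add_le_add le_rfl ih)

/-- Minkowski's inequality for countable sums. -/
theorem lNorm_tsum_le (hp : 1 ≤ p) (a : ℕ → ι → ℝ≥0∞) :
    lNorm p (fun i => ∑' n, a n i) ≤ ∑' n, lNorm p (a n) := by
  have key : ∀ N, lNorm p (fun i => ∑ n ∈ Finset.range N, a n i) ≤ ∑' n, lNorm p (a n) :=
    fun N => (lNorm_sum_le hp a _).trans (ENNReal.sum_le_tsum _)
  by_cases h : p = ∞
  · subst h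
    rw [lNorm_top]
    refine iSup_le fun i => ENNReal.tsum_le_of_sum_range_le fun N => ?_
    exact (le_lNorm hp (fun i => ∑ n ∈ Finset.range N, a n i) i).trans (key N)
  · refine lNorm_le_of_sum_rpow_rpow_le hp h fun s => ?_
    have ht : Tendsto (fun N => (∑ i ∈ s, (∑ n ∈ Finset.range N, a n i) ^ p.toReal)
        ^ (1 / p.toReal)) atTop
        (𝓝 ((∑ i ∈ s, (∑' n, a n i) ^ p.toReal) ^ (1 / p.toReal))) := by
      refine (ENNReal.continuous_rpow_const.tendsto _).comp ?_
      refine tendsto_finsetSum _ fun i _ => ?_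
      exact (ENNReal.continuous_rpow_const.tendsto _).comp (ENNReal.tendsto_nat_tsum _)
    exact le_of_tendsto' ht fun N => (sum_rpow_rpow_le_lNorm h _ s).trans (key N)

/-- For each `i`, the `p`-th power of the supremum over `k` is at most the sum of the `p`-th powers.
This absorbs the translation index `k'` when a wavelet series is evaluated at a point. -/
theorem lNorm_iSup_le (hp : 1 ≤ p) (a : ι × κ → ℝ≥0∞) :
    lNorm p (fun i => ⨆ k, a (i, k)) ≤ lNorm p a := by
  by_cases h : p = ∞
  · subst h
    simp only [lNorm_top]
    exact iSup_le fun i => iSup_le fun k => le_iSup a (i, k)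
  · have h1 := one_le_toReal hp h
    rw [lNorm_of_ne_top h, lNorm_of_ne_top h]
    refine ENNReal.rpow_le_rpow ?_ (by positivity)
    rw [ENNReal.tsum_prod' (f := fun x => a x ^ p.toReal)]
    refine ENNReal.tsum_le_tsum fun i => ?_
    rw [← ENNReal.le_rpow_inv_iff (by positivity)]
    refine iSup_le fun k => ?_
    rw [ENNReal.le_rpow_inv_iff (by positivity)]
    exact ENNReal.le_tsum (f := fun k => a (i, k) ^ p.toReal) k

/-- Write `x² = x^p x^{2-p}` and bound the second factor by the `(2-p)`-th power of the norm. -/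
theorem tsum_sq_le_lNorm_sq (hp : 1 ≤ p) (hp2 : p ≤ 2) (a : ι → ℝ≥0∞) :
    ∑' i, a i ^ 2 ≤ lNorm p a ^ 2 := by
  have h : p ≠ ∞ := ne_top_of_le_ne_top (by simp) hp2
  have h1 := one_le_toReal hp h
  have h2 : p.toReal ≤ 2 := by simpa using (ENNReal.toReal_le_toReal h (by simp)).2 hp2
  have hsplit : ∀ x : ℝ≥0∞, x ^ 2 = x ^ p.toReal * x ^ (2 - p.toReal) := fun x => by
    rw [← ENNReal.rpow_add_of_nonneg _ _ (by linarith) (by linarith), add_sub_cancel]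
    exact_mod_cast (ENNReal.rpow_natCast x 2).symm
  have hs : ∑' i, a i ^ p.toReal = lNorm p a ^ p.toReal := by
    rw [lNorm_of_ne_top h, ← ENNReal.rpow_mul, one_div_mul_cancel (by positivity),
      ENNReal.rpow_one]
  rw [hsplit (lNorm p a), ← hs, ← ENNReal.tsum_mul_right]
  refine ENNReal.tsum_le_tsum fun i => ?_
  rw [hsplit]
  exact mul_le_mul_right (ENNReal.rpow_le_rpow (le_lNorm hp a i) (by linarith)) _

theorem sum_sq_le_card_mul_lNorm_sq [Fintype ι] (hp : 1 ≤ p) (a : ι → ℝ≥0∞) :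
    ∑ i, a i ^ 2 ≤ Fintype.card ι * lNorm p a ^ 2 := by
  refine (Finset.sum_le_card_nsmul _ _ (lNorm p a ^ 2) fun i _ => ?_).trans ?_
  · exact pow_le_pow_left' (le_lNorm hp a i) 2
  · simp

end lNorm

/-! ### Periodizations of compactly supported functions -/

theorem exists_support_bound {g : ℝ → ℂ} (hg : HasCompactSupport g) :
    ∃ R : ℕ, ∀ x : ℝ, (R : ℝ) < |x| → g x = 0 := by
  obtain ⟨r, hr⟩ := (hg.isCompact.isBounded).subset_closedBall (0 : ℝ)
  obtain ⟨R, hR⟩ := exists_nat_ge r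
  refine ⟨R, fun x hx => ?_⟩
  by_contra h
  have := hr (subset_tsupport g h)
  rw [mem_closedBall_zero_iff, Real.norm_eq_abs] at this
  linarith

/-- For `t ∈ [0,1]` and `k < 2^j` only boundedly many terms of the periodization of a compactly
supported function are nonzero. -/
theorem periodized_eq_sum {g : ℝ → ℂ} {R : ℕ} (hR : ∀ x : ℝ, (R : ℝ) < |x| → g x = 0)
    {j k : ℕ} (hk : k < 2 ^ j) {t : ℝ} (ht : t ∈ Icc (0 : ℝ) 1) :
    periodized g j k t = ∑ n ∈ Finset.Icc (-(R + 2 : ℤ)) (R + 2),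
      (((2 : ℝ) ^ ((j : ℝ) / 2) : ℝ) : ℂ) * g ((2 : ℝ) ^ j * (t + n) - k) := by
  refine tsum_eq_sum fun n hn => ?_
  -- If `|n| > R + 2`, then `|t + n| ≥ R + 2`; the shift by `k < 2^j` costs less than one unit at
  -- scale `2^j`, so the argument of `g` still exceeds `R` in absolute value.
  rw [hR, mul_zero]
  have hk' : (k : ℝ) < 2 ^ j := by exact_mod_cast hk
  have hk0 : (0 : ℝ) ≤ k := k.cast_nonneg
  have h1 : (1 : ℝ) ≤ 2 ^ j := one_le_pow₀ (by norm_num)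
  have hR0 : (0 : ℝ) ≤ R := R.cast_nonneg
  obtain ⟨ht0, ht1⟩ := ht
  rw [Finset.mem_Icc, not_and_or, not_le, not_le] at hn
  rcases hn with hn | hn
  · have : (n : ℝ) ≤ -(R + 2) - 1 := by exact_mod_cast Int.le_sub_one_of_lt hn
    rw [lt_abs]
    right
    nlinarith [mul_le_mul_of_nonneg_left (show t + n ≤ -(R + 1) by linarith)
      (show (0 : ℝ) ≤ 2 ^ j by positivity)]
  · have : (R : ℝ) + 2 + 1 ≤ n := by exact_mod_cast Int.add_one_le_of_lt hn
    rw [lt_abs]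
    left
    nlinarith [mul_le_mul_of_nonneg_left (show (R : ℝ) + 2 ≤ t + n by linarith)
      (show (0 : ℝ) ≤ 2 ^ j by positivity)]

theorem continuousOn_periodized {g : ℝ → ℂ} (hg : HasCompactSupport g) (hc : Continuous g)
    {j k : ℕ} (hk : k < 2 ^ j) : ContinuousOn (periodized g j k) (Icc 0 1) := by
  obtain ⟨R, hR⟩ := exists_support_bound hg
  refine ContinuousOn.congr (Continuous.continuousOn ?_)
    (fun t ht => periodized_eq_sum hR hk ht)
  fun_prop

theorem sum_norm_periodized_le {g : ℝ → ℂ} (hg : HasCompactSupport g) (hc : Continuous g) :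
    ∃ K : ℝ, 0 < K ∧ ∀ (j : ℕ), ∀ t ∈ Icc (0 : ℝ) 1,
      ∑ k : Fin (2 ^ j), ‖periodized g j k t‖ ≤ K * (2 : ℝ) ^ ((j : ℝ) / 2) := by
  obtain ⟨R, hR⟩ := exists_support_bound hg
  obtain ⟨M, hM⟩ := hg.exists_bound_of_continuous hc
  have hM0 : 0 ≤ M := (norm_nonneg _).trans (hM 0)
  -- At most `2R + 1` pairs `(k, n)` contribute, each at most `2^{j/2} M`; `M + 1` keeps the
  -- constant positive.
  refine ⟨(2 * R + 1) * (M + 1), by positivity, fun j t ht => ?_⟩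
  set c : ℝ := (2 : ℝ) ^ ((j : ℝ) / 2)
  have hc0 : 0 ≤ c := by positivity
  set I : Finset ℤ := Finset.Icc (-(R + 2 : ℤ)) (R + 2)
  set x : ℝ := 2 ^ j * t
  set S : Finset (Fin (2 ^ j) × ℤ) :=
    (Finset.univ ×ˢ I).filter fun y => |2 ^ j * (t + y.2) - (y.1 : ℕ)| ≤ (R : ℝ)
  have hcard : (S.card : ℝ) ≤ 2 * R + 1 := by
    have hinj : S.card ≤ (Finset.Icc ⌈x - R⌉ ⌊x + R⌋).card := by
      -- A contributing pair gives an integer `k - 2^j n` within `R` of `x = 2^j t`. The pair is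
      -- recovered from it, because `k` is its residue modulo `2^j`.
      refine Finset.card_le_card_of_injOn (fun y => ((y.1 : ℕ) : ℤ) - 2 ^ j * y.2) ?_ ?_
      · intro y hy
        have hy' := (Finset.mem_filter.1 (Finset.mem_coe.1 hy)).2
        rw [abs_le] at hy'
        simp only [Finset.coe_Icc, mem_Icc, Int.ceil_le, Int.le_floor]
        push_cast
        constructor <;> simp only [x] <;> linarith [hy'.1, hy'.2]
      · rintro ⟨⟨k, hk⟩, n⟩ _ ⟨⟨k', hk'⟩, n'⟩ _ h
        simp only at h
        have hkz : (k : ℤ) < 2 ^ j := by exact_mod_cast hk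
        have hkz' : (k' : ℤ) < 2 ^ j := by exact_mod_cast hk'
        have hmod : (k : ℤ) = k' := by
          have h1 : (k : ℤ) = k' + 2 ^ j * (n - n') := by linarith
          have h2 := congrArg (· % (2 ^ j : ℤ)) h1
          simp only [Int.add_mul_emod_self_left] at h2
          rwa [Int.emod_eq_of_lt (by positivity) hkz,
            Int.emod_eq_of_lt (by positivity) hkz'] at h2
        have hn : n = n' := by
          rw [hmod] at h
          have h3 : (2 ^ j : ℤ) * n = 2 ^ j * n' := by linarith
          exact mul_left_cancel₀ (by positivity) h3
        have : k = k' := by exact_mod_cast hmod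
        subst this hn
        rfl
    have h2 : ((Finset.Icc ⌈x - R⌉ ⌊x + R⌋).card : ℝ) ≤ 2 * R + 1 := by
      rw [Int.card_Icc]
      have h3 : (((⌊x + R⌋ + 1 - ⌈x - R⌉).toNat : ℤ) : ℝ) ≤ 2 * R + 1 := by
        rw [Int.toNat_eq_max, Int.cast_max]
        refine max_le ?_ (by push_cast; positivity)
        push_cast
        linarith [Int.floor_le (x + R), Int.le_ceil (x - R)]
      exact_mod_cast h3
    exact (Nat.cast_le.2 hinj).trans h2
  calc ∑ k : Fin (2 ^ j), ‖periodized g j k t‖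
      ≤ ∑ k : Fin (2 ^ j), ∑ n ∈ I, c * ‖g ((2 : ℝ) ^ j * (t + n) - (k : ℕ))‖ := by
        refine Finset.sum_le_sum fun k _ => ?_
        rw [periodized_eq_sum hR k.2 ht]
        refine (norm_sum_le _ _).trans (le_of_eq (Finset.sum_congr rfl fun n _ => ?_))
        rw [norm_mul, Complex.norm_real, Real.norm_of_nonneg hc0]
    _ = ∑ y ∈ (Finset.univ : Finset (Fin (2 ^ j))) ×ˢ I, c * ‖g ((2 : ℝ) ^ j * (t + y.2) - (y.1 : ℕ))‖ := by
        rw [Finset.sum_product]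
    _ = ∑ y ∈ S, c * ‖g ((2 : ℝ) ^ j * (t + y.2) - (y.1 : ℕ))‖ := by
        refine (Finset.sum_filter_of_ne fun y _ hy => ?_).symm
        by_contra h
        exact hy (by rw [hR _ (not_le.1 h), norm_zero, mul_zero])
    _ ≤ ∑ _y ∈ S, c * M := by
        gcongr
        exact hM _
    _ = S.card * (c * M) := by simp
    _ ≤ (2 * R + 1) * (c * (M + 1)) := by
        gcongr
        linarith
    _ = (2 * R + 1) * (M + 1) * c := by ring

theorem IsFinitelySupportedWaveletBasis.continuousOn_wavelet {s₀ m₀ : ℕ} {ξ η : ℝ → ℂ}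
    (h : IsFinitelySupportedWaveletBasis s₀ m₀ ξ η) (i : ℕ) (k : Fin (levelCard m₀ i)) :
    ContinuousOn (wavelet m₀ ξ η i k) (Icc 0 1) := by
  cases i with
  | zero => exact continuousOn_periodized h.compact_scaling h.regular_scaling.continuous k.2
  | succ n => exact continuousOn_periodized h.compact_wavelet h.regular_wavelet.continuous k.2

theorem IsFinitelySupportedWaveletBasis.sum_norm_wavelet_le {s₀ m₀ : ℕ} {ξ η : ℝ → ℂ}
    (h : IsFinitelySupportedWaveletBasis s₀ m₀ ξ η) :
    ∃ K : ℝ, 0 < K ∧ ∀ (i : ℕ), ∀ t ∈ Icc (0 : ℝ) 1,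
      ∑ k : Fin (levelCard m₀ i), ‖wavelet m₀ ξ η i k t‖ ≤ K * (2 : ℝ) ^ (level m₀ i / 2) := by
  obtain ⟨K₁, hK₁, h₁⟩ := sum_norm_periodized_le h.compact_scaling h.regular_scaling.continuous
  obtain ⟨K₂, hK₂, h₂⟩ := sum_norm_periodized_le h.compact_wavelet h.regular_wavelet.continuous
  refine ⟨2 * K₁ + K₂, by positivity, fun i t ht => ?_⟩
  cases i with
  | zero =>
    refine (h₁ m₀ t ht).trans ?_
    -- The scaling functions have resolution `m₀` but carry the level `m₀ - 1`, which costs a factor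
    -- `√2 ≤ 2`.
    have e : (2 : ℝ) ^ ((m₀ : ℝ) / 2) = 2 ^ (1 / 2 : ℝ) * 2 ^ (level m₀ 0 / 2) := by
      rw [← Real.rpow_add two_pos, level]
      congr 1
      push_cast
      ring
    have h2 : (2 : ℝ) ^ (1 / 2 : ℝ) ≤ 2 := by
      simpa using Real.rpow_le_rpow_of_exponent_le (x := 2) one_le_two
        (show (1 / 2 : ℝ) ≤ 1 by norm_num)
    have h3 : (0 : ℝ) < 2 ^ (level m₀ 0 / 2) := by positivity
    rw [e]
    calc K₁ * (2 ^ (1 / 2 : ℝ) * 2 ^ (level m₀ 0 / 2)) ≤ K₁ * (2 * 2 ^ (level m₀ 0 / 2)) := by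
          gcongr
      _ ≤ (2 * K₁ + K₂) * 2 ^ (level m₀ 0 / 2) := by nlinarith
  | succ n =>
    refine (h₂ (m₀ + n) t ht).trans ?_
    have e : ((m₀ + n : ℕ) : ℝ) = level m₀ (n + 1) := by
      rw [level]
      push_cast
      ring
    rw [e]
    gcongr
    linarith

/-! ### Square summability of the hyperbolic coefficients -/

theorem summable_rpow_level (m₀ : ℕ) {δ : ℝ} (hδ : 0 < δ) :
    Summable fun i : ℕ => (2 : ℝ) ^ (level m₀ i * -δ) := by
  have h : ∀ i : ℕ, (2 : ℝ) ^ (level m₀ i * -δ) =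
      2 ^ (((m₀ : ℝ) - 1) * -δ) * ((2 : ℝ) ^ (-δ)) ^ i := fun i => by
    rw [← Real.rpow_natCast, ← Real.rpow_mul two_pos.le, ← Real.rpow_add two_pos, level]
    congr 1
    ring
  simp_rw [h]
  refine (summable_geometric_of_lt_one (by positivity) ?_).mul_left _
  exact Real.rpow_lt_one_of_one_lt_of_neg one_lt_two (neg_lt_zero.2 hδ)

theorem levelCard_pos (m₀ i : ℕ) : 0 < levelCard m₀ i := by
  cases i <;> simp [levelCard]

theorem levelCard_le (m₀ i : ℕ) : (levelCard m₀ i : ℝ) ≤ 2 * 2 ^ level m₀ i := by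
  cases i with
  | zero =>
    have : (2 : ℝ) * 2 ^ level m₀ 0 = 2 ^ (m₀ : ℝ) := by
      conv_lhs => rw [← Real.rpow_one 2, ← Real.rpow_mul two_pos.le, ← Real.rpow_add two_pos]
      congr 1
      simp [level]
    rw [this, levelCard, Real.rpow_natCast]
    push_cast
    exact le_rfl
  | succ n =>
    have : level m₀ (n + 1) = ((m₀ + n : ℕ) : ℝ) := by
      rw [level]
      push_cast
      ring
    rw [this, levelCard, Real.rpow_natCast]
    push_cast
    linarith [show (0 : ℝ) < 2 ^ (m₀ + n) by positivity]

/-- The norm defining the Besov ball of mixed regularity, for a family of coefficients. -/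
def mixedNorm (m₀ m₀' : ℕ) (s₁ s₂ : ℝ) (p q : ℝ≥0∞) (β : ℕ → ℕ → ℕ → ℕ → ℂ) : ℝ≥0∞ :=
  lNorm q (fun i : ℕ × ℕ =>
    ENNReal.ofReal ((2 : ℝ) ^ (level m₀ i.1 * sStar s₁ p + level m₀' i.2 * sStar s₂ p)) *
      lNorm p (fun k : Fin (levelCard m₀ i.1) × Fin (levelCard m₀' i.2) =>
        ‖β i.1 k.1 i.2 k.2‖ₑ))

theorem le_ofReal_of_ofReal_rpow_mul_le {x A : ℝ} {a : ℝ≥0∞}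
    (h : ENNReal.ofReal ((2 : ℝ) ^ x) * a ≤ ENNReal.ofReal A) :
    a ≤ ENNReal.ofReal (A * 2 ^ (-x)) := by
  have h1 : ENNReal.ofReal ((2 : ℝ) ^ (-x)) * ENNReal.ofReal ((2 : ℝ) ^ x) = 1 := by
    rw [← ENNReal.ofReal_mul (by positivity), ← Real.rpow_add two_pos, neg_add_cancel,
      Real.rpow_zero, ENNReal.ofReal_one]
  calc a = ENNReal.ofReal ((2 : ℝ) ^ (-x)) * (ENNReal.ofReal ((2 : ℝ) ^ x) * a) := by
        rw [← mul_assoc, h1, one_mul]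
    _ ≤ ENNReal.ofReal ((2 : ℝ) ^ (-x)) * ENNReal.ofReal A := by gcongr
    _ = ENNReal.ofReal (A * 2 ^ (-x)) := by
        rw [← ENNReal.ofReal_mul (by positivity), mul_comm]

/-- On a single level the `ℓ²` norm is controlled by the `ℓ^p` norm up to a power of `2^j` that
is smaller than `s₁^*`. -/
theorem sum_sq_level_le (m₀ : ℕ) {p : ℝ≥0∞} (hp : 1 ≤ p) {s₁ : ℝ}
    (hs₁ : max (p⁻¹).toReal (1 / 2) ≤ s₁) :
    ∃ δ : ℝ, 0 < δ ∧ ∀ (i : ℕ) (a : Fin (levelCard m₀ i) → ℝ≥0∞),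
      ∑ k, a k ^ 2 ≤
        ENNReal.ofReal (2 * 2 ^ (level m₀ i * (2 * sStar s₁ p - δ))) * lNorm p a ^ 2 := by
  have h1 := (le_max_left _ _).trans hs₁
  have h2 := (le_max_right _ _).trans hs₁
  by_cases hp2 : p ≤ 2
  -- For `p ≤ 2`, `ℓ^p` embeds in `ℓ²` with no loss, and `s₁ ≥ 1/p` gives `s₁^* ≥ 1/2`.
  · refine ⟨2 * sStar s₁ p, by rw [sStar]; linarith, fun i a => ?_⟩
    rw [sub_self, mul_zero, Real.rpow_zero, ← tsum_fintype (L := .unconditional _)]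
    refine (tsum_sq_le_lNorm_sq hp hp2 a).trans (le_mul_of_one_le_left' ?_)
    rw [ENNReal.one_le_ofReal]
    norm_num
  · push Not at hp2
    have h3 : (p⁻¹).toReal < 1 / 2 := by
      have := (ENNReal.toReal_lt_toReal (by simp; positivity) (by simp)).2
        (ENNReal.inv_lt_inv.2 hp2)
      simpa using this
    -- For `p > 2` each entry is bounded by the `ℓ^p` norm and the number of entries costs `2 ·
    -- 2^j`; here `δ = 2(s₁ - 1/p)`, positive because `s₁ ≥ 1/2 > 1/p`.
    refine ⟨2 * sStar s₁ p - 1, by rw [sStar]; linarith, fun i a => ?_⟩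
    refine (sum_sq_le_card_mul_lNorm_sq hp a).trans ?_
    gcongr
    rw [Fintype.card_fin, ← ENNReal.ofReal_natCast]
    refine ENNReal.ofReal_le_ofReal ((levelCard_le m₀ i).trans (le_of_eq ?_))
    congr 2
    ring

theorem exists_tsum_sq_le (m₀ m₀' : ℕ) {p q : ℝ≥0∞} (hp : 1 ≤ p) (hq : 1 ≤ q) {s₁ : ℝ} (s₂ : ℝ)
    (hs₁ : max (p⁻¹).toReal (1 / 2) ≤ s₁) :
    ∃ C : ℝ, 0 ≤ C ∧ ∀ A : ℝ, 0 < A → ∀ β : ℕ → ℕ → ℕ → ℕ → ℂ,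
      mixedNorm m₀ m₀' s₁ s₂ p q β ≤ ENNReal.ofReal A →
      ∀ (i' : ℕ) (k' : Fin (levelCard m₀' i')),
        ∑' x : Σ i : ℕ, Fin (levelCard m₀ i), ‖β x.1 x.2 i' k'‖ₑ ^ 2 ≤
          ENNReal.ofReal ((C * A * 2 ^ (level m₀' i' * -sStar s₂ p)) ^ 2) := by
  obtain ⟨δ, hδ, H⟩ := sum_sq_level_le m₀ hp hs₁
  have hsum := (summable_rpow_level m₀ hδ).mul_left 2
  set T : ℝ := ∑' i : ℕ, 2 * (2 : ℝ) ^ (level m₀ i * -δ)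
  have hT : 0 ≤ T := tsum_nonneg fun i => by positivity
  refine ⟨√T, Real.sqrt_nonneg _, fun A hA β hβ i' k' => ?_⟩
  set D : ℝ := A * 2 ^ (level m₀' i' * -sStar s₂ p)
  have hD : 0 ≤ D := by positivity
  have hlev : ∀ i : ℕ, ∑ k : Fin (levelCard m₀ i), ‖β i k i' k'‖ₑ ^ 2 ≤
      ENNReal.ofReal (2 * 2 ^ (level m₀ i * -δ) * D ^ 2) := fun i => by
    have h1 : lNorm p (fun k : Fin (levelCard m₀ i) => ‖β i k i' k'‖ₑ) ≤
        ENNReal.ofReal (D * 2 ^ (level m₀ i * -sStar s₁ p)) := by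
      have h2 := le_ofReal_of_ofReal_rpow_mul_le ((le_lNorm hq _ (i, i')).trans hβ)
      refine ((lNorm_comp_le (e := fun k => (k, k')) (fun k l h => (Prod.ext_iff.1 h).1)
        (fun k : Fin (levelCard m₀ i) × Fin (levelCard m₀' i') =>
          ‖β i k.1 i' k.2‖ₑ)).trans h2).trans (le_of_eq ?_)
      simp only [D]
      rw [mul_assoc, ← Real.rpow_add two_pos]
      congr 3
      ring
    refine (H i _).trans ?_
    calc _ ≤ ENNReal.ofReal (2 * 2 ^ (level m₀ i * (2 * sStar s₁ p - δ))) *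
          ENNReal.ofReal (D * 2 ^ (level m₀ i * -sStar s₁ p)) ^ 2 := by gcongr
      _ = _ := by
        rw [← ENNReal.ofReal_pow (by positivity), ← ENNReal.ofReal_mul (by positivity)]
        congr 1
        have : (2 : ℝ) ^ (level m₀ i * -δ) = 2 ^ (level m₀ i * (2 * sStar s₁ p - δ)) *
            (2 ^ (level m₀ i * -sStar s₁ p)) ^ 2 := by
          rw [← Real.rpow_natCast _ 2, ← Real.rpow_mul two_pos.le, ← Real.rpow_add two_pos]
          congr 1
          push_cast
          ring
        rw [this]
        ring
  rw [ENNReal.tsum_sigma (fun i (k : Fin (levelCard m₀ i)) => ‖β i k i' k'‖ₑ ^ 2)]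
  calc ∑' i, ∑' k : Fin (levelCard m₀ i), ‖β i k i' k'‖ₑ ^ 2
      ≤ ∑' i : ℕ, ENNReal.ofReal (2 * 2 ^ (level m₀ i * -δ) * D ^ 2) := by
        refine ENNReal.tsum_le_tsum fun i => ?_
        rw [tsum_fintype]
        exact hlev i
    _ = ENNReal.ofReal (T * D ^ 2) := by
        rw [← ENNReal.ofReal_tsum_of_nonneg (fun i => by positivity) (hsum.mul_right _),
          tsum_mul_right]
    _ = _ := by
        congr 1
        rw [mul_assoc, mul_pow √T, Real.sq_sqrt hT]

theorem exists_lp_of_tsum_sq_le {ι : Type*} {a : ι → ℂ} {D : ℝ} (hD : 0 ≤ D)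
    (h : ∑' x, ‖a x‖ₑ ^ 2 ≤ ENNReal.ofReal (D ^ 2)) :
    ∃ v : lp (fun _ : ι => ℂ) 2, (∀ x, v x = a x) ∧ ‖v‖ ≤ D := by
  have he : ∀ x, ‖a x‖ₑ ^ 2 = ENNReal.ofReal (‖a x‖ ^ 2) := fun x => by
    rw [ENNReal.ofReal_pow (norm_nonneg _), ofReal_norm]
  simp_rw [he] at h
  have hs : Summable fun x => ‖a x‖ ^ 2 := by
    have := ENNReal.summable_toReal (ne_top_of_le_ne_top ENNReal.ofReal_ne_top h)
    simpa [ENNReal.toReal_ofReal] using this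
  have hm : Memℓp a 2 := memℓp_gen (by simpa using hs)
  refine ⟨⟨a, hm⟩, fun x => rfl, lp.norm_le_of_tsum_le (by simp) hD ?_⟩
  rw [← ENNReal.ofReal_tsum_of_nonneg (fun x => by positivity) hs,
    ENNReal.ofReal_le_ofReal_iff (by positivity)] at h
  simpa using h

/-! ### Synthesis of vector-valued functions -/

section synthesis

variable {E F : Type*} [NormedAddCommGroup E] [NormedSpace ℂ E] [NormedAddCommGroup F]
  [NormedSpace ℂ F]

/-- The contribution of a single level to a wavelet series with coefficients in `E`. -/
def levelSum (m₀ : ℕ) (ξ η : ℝ → ℂ) (B : ∀ i : ℕ, Fin (levelCard m₀ i) → E) (i : ℕ) (u : ℝ) : E :=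
  ∑ k : Fin (levelCard m₀ i), wavelet m₀ ξ η i k u • B i k

/-- The wavelet series with coefficients `B i k` in a normed space. -/
def synthesis (m₀ : ℕ) (ξ η : ℝ → ℂ) (B : ∀ i : ℕ, Fin (levelCard m₀ i) → E) (u : ℝ) : E :=
  ∑' i, levelSum m₀ ξ η B i u

variable {s₀ m₀ : ℕ} {ξ η : ℝ → ℂ} {B : ∀ i : ℕ, Fin (levelCard m₀ i) → E} {D t : ℝ}

theorem IsFinitelySupportedWaveletBasis.continuousOn_levelSum
    (h : IsFinitelySupportedWaveletBasis s₀ m₀ ξ η) (i : ℕ) :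
    ContinuousOn (levelSum m₀ ξ η B i) (Icc 0 1) :=
  continuousOn_finsetSum Finset.univ fun k _ => (h.continuousOn_wavelet i k).smul continuousOn_const

theorem IsFinitelySupportedWaveletBasis.exists_norm_levelSum_le
    (h : IsFinitelySupportedWaveletBasis s₀ m₀ ξ η) (ht : 1 / 2 < t)
    (hB : ∀ i k, ‖B i k‖ ≤ D * 2 ^ (level m₀ i * -t)) :
    ∃ r : ℕ → ℝ, Summable r ∧ ∀ i, ∀ u ∈ Icc (0 : ℝ) 1, ‖levelSum m₀ ξ η B i u‖ ≤ r i := by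
  obtain ⟨K, hK, hle⟩ := h.sum_norm_wavelet_le
  refine ⟨fun i => K * D * 2 ^ (level m₀ i * -(t - 1 / 2)),
    (summable_rpow_level m₀ (by linarith)).mul_left _, fun i u hu => ?_⟩
  have h0 : 0 ≤ D * 2 ^ (level m₀ i * -t) :=
    (norm_nonneg _).trans (hB i ⟨0, levelCard_pos m₀ i⟩)
  calc ‖levelSum m₀ ξ η B i u‖
      ≤ ∑ k : Fin (levelCard m₀ i), ‖wavelet m₀ ξ η i k u‖ * (D * 2 ^ (level m₀ i * -t)) := by
        refine (norm_sum_le _ _).trans (Finset.sum_le_sum fun k _ => ?_)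
        rw [norm_smul]
        exact mul_le_mul_of_nonneg_left (hB i k) (norm_nonneg _)
    _ ≤ K * 2 ^ (level m₀ i / 2) * (D * 2 ^ (level m₀ i * -t)) := by
        rw [← Finset.sum_mul]
        exact mul_le_mul_of_nonneg_right (hle i u hu) h0
    _ = K * D * 2 ^ (level m₀ i * -(t - 1 / 2)) := by
        have : (2 : ℝ) ^ (level m₀ i * -(t - 1 / 2)) =
            2 ^ (level m₀ i / 2) * 2 ^ (level m₀ i * -t) := by
          rw [← Real.rpow_add two_pos]
          congr 1
          ring
        rw [this]
        ring

theorem IsFinitelySupportedWaveletBasis.continuousOn_synthesis [CompleteSpace E]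
    (h : IsFinitelySupportedWaveletBasis s₀ m₀ ξ η) (ht : 1 / 2 < t)
    (hB : ∀ i k, ‖B i k‖ ≤ D * 2 ^ (level m₀ i * -t)) :
    ContinuousOn (synthesis m₀ ξ η B) (Icc 0 1) := by
  obtain ⟨r, hr, hle⟩ := h.exists_norm_levelSum_le ht hB
  exact continuousOn_tsum (fun i => h.continuousOn_levelSum i) hr hle

theorem IsFinitelySupportedWaveletBasis.summable_levelSum [CompleteSpace E]
    (h : IsFinitelySupportedWaveletBasis s₀ m₀ ξ η) (ht : 1 / 2 < t)
    (hB : ∀ i k, ‖B i k‖ ≤ D * 2 ^ (level m₀ i * -t)) {u : ℝ} (hu : u ∈ Icc (0 : ℝ) 1) :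
    Summable fun i => levelSum m₀ ξ η B i u := by
  obtain ⟨r, hr, hle⟩ := h.exists_norm_levelSum_le ht hB
  exact Summable.of_norm_bounded hr fun i => hle i u hu

/-- Applied to coordinate functionals on `ℓ²`, this reduces the vector-valued series to scalar ones.
-/
theorem IsFinitelySupportedWaveletBasis.map_synthesis [CompleteSpace E]
    (h : IsFinitelySupportedWaveletBasis s₀ m₀ ξ η) (ht : 1 / 2 < t)
    (hB : ∀ i k, ‖B i k‖ ≤ D * 2 ^ (level m₀ i * -t)) (T : E →L[ℂ] F) {u : ℝ}
    (hu : u ∈ Icc (0 : ℝ) 1) :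
    T (synthesis m₀ ξ η B u) = synthesis m₀ ξ η (fun i k => T (B i k)) u := by
  rw [synthesis, T.map_tsum (h.summable_levelSum ht hB hu), synthesis]
  simp [levelSum, map_sum]

end synthesis

/-! ### Coefficients with respect to a wavelet basis -/

section coeff

variable {m₀ : ℕ} {φ ψ : ℝ → ℂ}

theorem coeff_congr_ae {g h : ℝ → ℂ} (e : g =ᵐ[unitMeasure] h) (i k : ℕ) :
    coeff m₀ φ ψ g i k = coeff m₀ φ ψ h i k := by
  refine integral_congr_ae ?_
  filter_upwards [e] with t ht
  rw [ht]

variable {b : HilbertBasis (Σ i : ℕ, Fin (levelCard m₀ i)) ℂ (Lp ℂ 2 unitMeasure)}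

theorem memLp_wavelet
    (hb : ∀ (i : ℕ) (k : Fin (levelCard m₀ i)), b ⟨i, k⟩ =ᵐ[unitMeasure] wavelet m₀ φ ψ i k)
    (i : ℕ) (k : Fin (levelCard m₀ i)) : MemLp (wavelet m₀ φ ψ i k) 2 unitMeasure :=
  (memLp_congr_ae (hb i k)).1 (Lp.memLp _)

theorem coeff_eq_repr
    (hb : ∀ (i : ℕ) (k : Fin (levelCard m₀ i)), b ⟨i, k⟩ =ᵐ[unitMeasure] wavelet m₀ φ ψ i k)
    (v : Lp ℂ 2 unitMeasure) (i : ℕ) (k : Fin (levelCard m₀ i)) :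
    coeff m₀ φ ψ v i k = b.repr v ⟨i, k⟩ := by
  rw [b.repr_apply_apply, L2.inner_def]
  refine integral_congr_ae ?_
  filter_upwards [hb i k] with t ht
  rw [RCLike.inner_apply, ht]

theorem coeff_eq_repr_toLp
    (hb : ∀ (i : ℕ) (k : Fin (levelCard m₀ i)), b ⟨i, k⟩ =ᵐ[unitMeasure] wavelet m₀ φ ψ i k)
    {g : ℝ → ℂ} (hg : MemLp g 2 unitMeasure) (i : ℕ) (k : Fin (levelCard m₀ i)) :
    coeff m₀ φ ψ g i k = b.repr (hg.toLp g) ⟨i, k⟩ := by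
  rw [← coeff_eq_repr hb, coeff_congr_ae hg.coeFn_toLp]

/-- A function of class `L²` is determined by its coefficients. -/
theorem ae_eq_of_coeff_eq
    (hb : ∀ (i : ℕ) (k : Fin (levelCard m₀ i)), b ⟨i, k⟩ =ᵐ[unitMeasure] wavelet m₀ φ ψ i k)
    {g h : ℝ → ℂ} (hg : MemLp g 2 unitMeasure) (hh : MemLp h 2 unitMeasure)
    (H : ∀ (i : ℕ) (k : Fin (levelCard m₀ i)), coeff m₀ φ ψ g i k = coeff m₀ φ ψ h i k) :
    g =ᵐ[unitMeasure] h := by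
  rw [← MemLp.toLp_eq_toLp_iff hg hh]
  refine b.repr.injective (lp.ext (funext fun x => ?_))
  rw [← coeff_eq_repr_toLp hb, ← coeff_eq_repr_toLp hb]
  exact H x.1 x.2

theorem coeff_wavelet
    (hb : ∀ (i : ℕ) (k : Fin (levelCard m₀ i)), b ⟨i, k⟩ =ᵐ[unitMeasure] wavelet m₀ φ ψ i k)
    (i : ℕ) (k : Fin (levelCard m₀ i)) (i' : ℕ) (k' : Fin (levelCard m₀ i')) :
    coeff m₀ φ ψ (wavelet m₀ φ ψ i k) i' k' =
      if (⟨i', k'⟩ : Σ i : ℕ, Fin (levelCard m₀ i)) = ⟨i, k⟩ then 1 else 0 := by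
  rw [← coeff_congr_ae (hb i k), coeff_eq_repr hb, b.repr_apply_apply,
    orthonormal_iff_ite.1 b.orthonormal]

theorem integrable_mul_conj_wavelet
    (hb : ∀ (i : ℕ) (k : Fin (levelCard m₀ i)), b ⟨i, k⟩ =ᵐ[unitMeasure] wavelet m₀ φ ψ i k)
    {g : ℝ → ℂ} (hg : MemLp g 2 unitMeasure) (i : ℕ) (k : Fin (levelCard m₀ i)) :
    Integrable (fun t => g t * conj (wavelet m₀ φ ψ i k t)) unitMeasure :=
  hg.integrable_mul (memLp_wavelet hb i k).star

theorem enorm_coeff_le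
    (hb : ∀ (i : ℕ) (k : Fin (levelCard m₀ i)), b ⟨i, k⟩ =ᵐ[unitMeasure] wavelet m₀ φ ψ i k)
    {g : ℝ → ℂ} (hg : MemLp g 2 unitMeasure) (i : ℕ) (k : Fin (levelCard m₀ i)) :
    ‖coeff m₀ φ ψ g i k‖ₑ ≤ eLpNorm g 2 unitMeasure := by
  have h : ‖coeff m₀ φ ψ g i k‖ ≤ ‖hg.toLp g‖ := by
    rw [coeff_eq_repr_toLp hb hg, ← b.repr.norm_map]
    exact lp.norm_apply_le_norm (by simp) _ _
  rw [Lp.norm_toLp] at h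
  rw [← ofReal_norm]
  exact (ENNReal.ofReal_le_ofReal h).trans ENNReal.ofReal_toReal_le

theorem coeff_sub
    (hb : ∀ (i : ℕ) (k : Fin (levelCard m₀ i)), b ⟨i, k⟩ =ᵐ[unitMeasure] wavelet m₀ φ ψ i k)
    {g h : ℝ → ℂ} (hg : MemLp g 2 unitMeasure) (hh : MemLp h 2 unitMeasure) (i : ℕ)
    (k : Fin (levelCard m₀ i)) :
    coeff m₀ φ ψ (fun t => g t - h t) i k = coeff m₀ φ ψ g i k - coeff m₀ φ ψ h i k := by
  simp only [coeff, sub_mul]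
  exact integral_sub (integrable_mul_conj_wavelet hb hg i k) (integrable_mul_conj_wavelet hb hh i k)

theorem ae_memLp_of_memLp_prod {f : ℝ × ℝ → ℂ} (hf : MemLp f 2 (unitMeasure.prod unitMeasure)) :
    ∀ᵐ u ∂unitMeasure, MemLp (fun t => f (u, t)) 2 unitMeasure := by
  have h1 : ∫⁻ z, ‖f z‖ₑ ^ (2 : ℝ) ∂(unitMeasure.prod unitMeasure) < ∞ := by
    simpa using lintegral_rpow_enorm_lt_top_of_eLpNorm_lt_top (by simp) (by simp) hf.2
  have hm : AEMeasurable (fun z => ‖f z‖ₑ ^ (2 : ℝ)) (unitMeasure.prod unitMeasure) :=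
    hf.1.enorm.pow_const _
  rw [lintegral_prod _ hm] at h1
  filter_upwards [hf.1.prodMk_left, ae_lt_top' hm.lintegral_prod_right' h1.ne] with u hu hlt
  refine ⟨hu, ?_⟩
  rw [eLpNorm_lt_top_iff_lintegral_rpow_enorm_lt_top (by simp) (by simp)]
  simpa using hlt

/-- By Fubini: the coefficient at `u` is at most the `L²` norm of the profile `f(u,·)`, whose square
is integrable in `u`. -/
theorem memLp_coeff
    (hb : ∀ (i : ℕ) (k : Fin (levelCard m₀ i)), b ⟨i, k⟩ =ᵐ[unitMeasure] wavelet m₀ φ ψ i k)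
    {f : ℝ × ℝ → ℂ} (hf : MemLp f 2 (unitMeasure.prod unitMeasure)) (i : ℕ)
    (k : Fin (levelCard m₀ i)) :
    MemLp (fun u => coeff m₀ φ ψ (fun t => f (u, t)) i k) 2 unitMeasure := by
  have h1 : ∫⁻ z, ‖f z‖ₑ ^ (2 : ℝ) ∂(unitMeasure.prod unitMeasure) < ∞ := by
    simpa using lintegral_rpow_enorm_lt_top_of_eLpNorm_lt_top (by simp) (by simp) hf.2
  have hm : AEMeasurable (fun z => ‖f z‖ₑ ^ (2 : ℝ)) (unitMeasure.prod unitMeasure) :=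
    hf.1.enorm.pow_const _
  refine ⟨?_, ?_⟩
  · have hw : AEStronglyMeasurable (fun z : ℝ × ℝ => conj (wavelet m₀ φ ψ i k z.2))
        (unitMeasure.prod unitMeasure) := (memLp_wavelet hb i k).star.1.comp_snd
    exact (hf.1.mul hw).integral_prod_right'
  · rw [eLpNorm_lt_top_iff_lintegral_rpow_enorm_lt_top (by simp) (by simp)]
    refine lt_of_le_of_lt ?_ h1
    rw [lintegral_prod _ hm]
    refine lintegral_mono_ae ?_
    filter_upwards [ae_memLp_of_memLp_prod hf] with u hu
    refine (ENNReal.rpow_le_rpow (enorm_coeff_le hb hu i k) (by simp)).trans (le_of_eq ?_)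
    rw [eLpNorm_eq_lintegral_rpow_enorm_toReal (by simp) (by simp), ← ENNReal.rpow_mul]
    simp

end coeff

theorem memLp_of_continuousOn {g : ℝ → ℂ} (hg : ContinuousOn g (Icc 0 1)) :
    MemLp g 2 unitMeasure := by
  obtain ⟨C, hC⟩ := isCompact_Icc.exists_bound_of_continuousOn hg
  refine MemLp.of_bound (hg.aestronglyMeasurable measurableSet_Icc) C ?_
  filter_upwards [ae_restrict_mem measurableSet_Icc] with u hu using hC u hu

/-- The coefficients of a wavelet series whose coefficients decay fast enough. -/
theorem IsFinitelySupportedWaveletBasis.coeff_synthesis {s₀ m₀ : ℕ} {ξ η : ℝ → ℂ}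
    {B : ∀ i : ℕ, Fin (levelCard m₀ i) → ℂ} {D s : ℝ}
    (h : IsFinitelySupportedWaveletBasis s₀ m₀ ξ η) (hs : 1 / 2 < s)
    (hB : ∀ i k, ‖B i k‖ ≤ D * 2 ^ (level m₀ i * -s)) (i : ℕ) (k : Fin (levelCard m₀ i)) :
    coeff m₀ ξ η (synthesis m₀ ξ η B) i k = B i k := by
  obtain ⟨b, hb⟩ := h.basis
  obtain ⟨r, hr, hle⟩ := h.exists_norm_levelSum_le hs hB
  set w : ℝ → ℂ := wavelet m₀ ξ η i k
  have hint : ∀ i', Integrable (fun u => levelSum m₀ ξ η B i' u * conj (w u)) unitMeasure :=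
    fun i' => integrable_mul_conj_wavelet hb (memLp_of_continuousOn (h.continuousOn_levelSum i')) i k
  obtain ⟨W, hW⟩ := isCompact_Icc.exists_bound_of_continuousOn (h.continuousOn_wavelet i k)
  -- Absolute summability of the integrals allows integrating term by term; orthonormality then
  -- leaves only level `i`.
  have hsum : Summable fun i' => ∫ u, ‖levelSum m₀ ξ η B i' u * conj (w u)‖ ∂unitMeasure := by
    refine Summable.of_nonneg_of_le (fun i' => integral_nonneg fun u => norm_nonneg _)
      (fun i' => ?_) (hr.mul_right W)
    have hb' : ∀ᵐ u ∂unitMeasure, ‖‖levelSum m₀ ξ η B i' u * conj (w u)‖‖ ≤ r i' * W := by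
      filter_upwards [ae_restrict_mem measurableSet_Icc] with u hu
      rw [norm_norm, norm_mul, RCLike.norm_conj]
      exact mul_le_mul (hle i' u hu) (hW u hu) (norm_nonneg _)
        ((norm_nonneg _).trans (hle i' u hu))
    have := norm_integral_le_of_norm_le_const hb'
    refine (le_abs_self _).trans (this.trans (le_of_eq ?_))
    simp [unitMeasure, Measure.real]
  have hs1 := hasSum_integral_of_summable_integral_norm hint hsum
  have hterm : ∀ i', ∫ u, levelSum m₀ ξ η B i' u * conj (w u) ∂unitMeasure =
      if i' = i then B i k else 0 := fun i' => by
    have e : ∀ u, levelSum m₀ ξ η B i' u * conj (w u) =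
        ∑ k' : Fin (levelCard m₀ i'), B i' k' * (wavelet m₀ ξ η i' k' u * conj (w u)) := fun u => by
      rw [levelSum, Finset.sum_mul]
      refine Finset.sum_congr rfl fun k' _ => ?_
      rw [smul_eq_mul]
      ring
    simp_rw [e]
    rw [integral_finsetSum _ fun k' _ =>
      (integrable_mul_conj_wavelet hb (memLp_wavelet hb i' k') i k).const_mul _]
    simp_rw [integral_const_mul]
    change ∑ k' : Fin (levelCard m₀ i'),
      B i' k' * coeff m₀ ξ η (wavelet m₀ ξ η i' k') i k = _
    simp_rw [coeff_wavelet hb]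
    by_cases hi : i' = i
    · subst hi
      simp
    · rw [if_neg hi]
      refine Finset.sum_eq_zero fun k' _ => ?_
      rw [if_neg, mul_zero]
      intro hh
      exact hi (Sigma.mk.inj_iff.1 hh).1.symm
  simp_rw [hterm] at hs1
  have hs2 := hs1.unique (hasSum_ite_eq i (B i k))
  rw [← hs2, coeff]
  refine integral_congr_ae (Eventually.of_forall fun u => ?_)
  simp only [synthesis]
  exact tsum_mul_right.symm

/-! ### The Besov norm of a profile -/

theorem half_lt_sStar {p : ℝ≥0∞} {s : ℝ} (hs : max (p⁻¹).toReal (1 / 2) < s) :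
    1 / 2 < sStar s p := by
  have := (le_max_left _ _).trans_lt hs
  rw [sStar]
  linarith

theorem enorm_levelSum_le (m₀ : ℕ) (ξ η : ℝ → ℂ) (B : ∀ i : ℕ, Fin (levelCard m₀ i) → ℂ) (i : ℕ)
    {u c : ℝ} (hc : ∑ k : Fin (levelCard m₀ i), ‖wavelet m₀ ξ η i k u‖ ≤ c) :
    ‖levelSum m₀ ξ η B i u‖ₑ ≤ ENNReal.ofReal c * ⨆ k, ‖B i k‖ₑ := by
  calc ‖levelSum m₀ ξ η B i u‖ₑ
      ≤ ∑ k : Fin (levelCard m₀ i), ‖wavelet m₀ ξ η i k u‖ₑ * ⨆ k, ‖B i k‖ₑ := by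
        refine (enorm_sum_le _ _).trans (Finset.sum_le_sum fun k _ => ?_)
        rw [smul_eq_mul, enorm_mul]
        gcongr
        exact le_iSup (fun k => ‖B i k‖ₑ) k
    _ ≤ ENNReal.ofReal c * ⨆ k, ‖B i k‖ₑ := by
        rw [← Finset.sum_mul]
        gcongr
        simp_rw [← ofReal_norm]
        rw [← ENNReal.ofReal_sum_of_nonneg fun _ _ => norm_nonneg _]
        exact ENNReal.ofReal_le_ofReal hc

/-- No summability is needed: the sum of a non-summable family is `0` by convention. -/
theorem enorm_tsum_le_tsum_enorm {E : Type*} [NormedAddCommGroup E] (a : ℕ → E) :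
    ‖∑' n, a n‖ₑ ≤ ∑' n, ‖a n‖ₑ := by
  by_cases h : Summable a
  · refine le_of_tendsto' h.hasSum.tendsto_sum_nat.enorm fun N => ?_
    exact (enorm_sum_le _ _).trans (ENNReal.sum_le_tsum _)
  · simp [tsum_eq_zero_of_not_summable h]

/-- Evaluation at a point `u` of the wavelet series in the second variable maps coefficients of
mixed regularity to coefficients of regularity `s₁`. -/
theorem IsFinitelySupportedWaveletBasis.exists_lNorm_synthesis_le {s₀ m₀' : ℕ} {ξ η : ℝ → ℂ}
    (h : IsFinitelySupportedWaveletBasis s₀ m₀' ξ η) (m₀ : ℕ) {p q : ℝ≥0∞} (hp : 1 ≤ p)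
    (hq : 1 ≤ q) (s₁ : ℝ) {s₂ : ℝ} (hs₂ : max (p⁻¹).toReal (1 / 2) < s₂) :
    ∃ C : ℝ, 0 < C ∧ ∀ A : ℝ, 0 < A → ∀ β : ℕ → ℕ → ℕ → ℕ → ℂ,
      mixedNorm m₀ m₀' s₁ s₂ p q β ≤ ENNReal.ofReal A → ∀ u ∈ Icc (0 : ℝ) 1,
      lNorm q (fun i : ℕ => ENNReal.ofReal ((2 : ℝ) ^ (level m₀ i * sStar s₁ p)) *
        lNorm p (fun k : Fin (levelCard m₀ i) =>
          ‖synthesis m₀' ξ η (fun i' k' => β i k i' k') u‖ₑ)) ≤ ENNReal.ofReal (C * A) := by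
  obtain ⟨K, hK, hle⟩ := h.sum_norm_wavelet_le
  have ht : 0 < sStar s₂ p - 1 / 2 := by linarith [half_lt_sStar hs₂]
  have hsum := (summable_rpow_level m₀' ht).mul_left K
  set r : ℕ → ℝ := fun i' => K * 2 ^ (level m₀' i' * -(sStar s₂ p - 1 / 2))
  have hr : ∀ i', 0 < r i' := fun i' => by positivity
  -- `r i'` is what remains at level `j'` when the pointwise growth `K 2^{j'/2}` is set against the
  -- weight `2^{j' s₂^*}`.
  refine ⟨∑' i', r i', hsum.tsum_pos (fun i' => (hr i').le) 0 (hr 0),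
    fun A hA β hβ u hu => ?_⟩
  set a : ℕ → ℕ → ℝ≥0∞ := fun i i' =>
    lNorm p (fun k : Fin (levelCard m₀ i) × Fin (levelCard m₀' i') => ‖β i k.1 i' k.2‖ₑ)
  set W : ℕ × ℕ → ℝ≥0∞ := fun i =>
    ENNReal.ofReal ((2 : ℝ) ^ (level m₀ i.1 * sStar s₁ p + level m₀' i.2 * sStar s₂ p)) * a i.1 i.2
  have hlev : ∀ i, lNorm p (fun k : Fin (levelCard m₀ i) =>
      ‖synthesis m₀' ξ η (fun i' k' => β i k i' k') u‖ₑ) ≤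
        ∑' i', ENNReal.ofReal (K * 2 ^ (level m₀' i' / 2)) * a i i' := fun i => by
    calc _ ≤ lNorm p (fun k : Fin (levelCard m₀ i) => ∑' i',
          ENNReal.ofReal (K * 2 ^ (level m₀' i' / 2)) *
            ⨆ k' : Fin (levelCard m₀' i'), ‖β i k i' k'‖ₑ) := by
          refine lNorm_mono fun k => (enorm_tsum_le_tsum_enorm _).trans ?_
          exact ENNReal.tsum_le_tsum fun i' => enorm_levelSum_le m₀' ξ η _ i' (hle i' u hu)
      _ ≤ _ := by
          refine (lNorm_tsum_le hp _).trans (ENNReal.tsum_le_tsum fun i' => ?_)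
          rw [lNorm_const_mul hp]
          gcongr
          exact lNorm_iSup_le hp
            (fun k : Fin (levelCard m₀ i) × Fin (levelCard m₀' i') => ‖β i k.1 i' k.2‖ₑ)
  calc _ ≤ lNorm q (fun i => ∑' i', ENNReal.ofReal (r i') * W (i, i')) := by
        refine lNorm_mono fun i => ?_
        refine (mul_le_mul_right (hlev i) _).trans (le_of_eq ?_)
        rw [← ENNReal.tsum_mul_left]
        refine tsum_congr fun i' => ?_
        simp only [W, r]
        rw [← mul_assoc, ← mul_assoc, ← ENNReal.ofReal_mul (by positivity),
          ← ENNReal.ofReal_mul (by positivity)]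
        congr 2
        rw [mul_left_comm, mul_assoc K, ← Real.rpow_add two_pos, ← Real.rpow_add two_pos]
        congr 2
        ring
    _ ≤ ∑' i', ENNReal.ofReal (r i') * ENNReal.ofReal A := by
        refine (lNorm_tsum_le hq _).trans (ENNReal.tsum_le_tsum fun i' => ?_)
        rw [lNorm_const_mul hq]
        gcongr
        exact (lNorm_comp_le (e := fun i => (i, i')) (fun k l h => (Prod.ext_iff.1 h).1) W).trans hβ
    _ = _ := by
        rw [ENNReal.tsum_mul_right, ← ENNReal.ofReal_tsum_of_nonneg (fun i' => (hr i').le) hsum,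
          ← ENNReal.ofReal_mul (tsum_nonneg fun i' => (hr i').le)]

/-! ### The continuous version -/

section version

variable {s₀ m₀ m₀' : ℕ} {φ ψ ξ η : ℝ → ℂ}
  {b : HilbertBasis (Σ i : ℕ, Fin (levelCard m₀ i)) ℂ (Lp ℂ 2 unitMeasure)}

/-- Both sides are `L²` functions of `u` with the same coefficients in the basis generated by `ξ`
and `η`. -/
theorem ae_coeff_eq_synthesis
    (hb : ∀ (i : ℕ) (k : Fin (levelCard m₀ i)), b ⟨i, k⟩ =ᵐ[unitMeasure] wavelet m₀ φ ψ i k)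
    (hη : IsFinitelySupportedWaveletBasis s₀ m₀' ξ η) {D s : ℝ} (hs : 1 / 2 < s)
    {f : ℝ × ℝ → ℂ} (hf : MemLp f 2 (unitMeasure.prod unitMeasure))
    (i : ℕ) (k : Fin (levelCard m₀ i))
    (hβ : ∀ (i' : ℕ) (k' : Fin (levelCard m₀' i')),
      ‖coeff₂ m₀ m₀' φ ψ ξ η f i k i' k'‖ ≤ D * 2 ^ (level m₀' i' * -s)) :
    ∀ᵐ u ∂unitMeasure, coeff m₀ φ ψ (fun t => f (u, t)) i k =
      synthesis m₀' ξ η (fun i' k' => coeff₂ m₀ m₀' φ ψ ξ η f i k i' k') u := by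
  obtain ⟨e, he⟩ := hη.basis
  refine ae_eq_of_coeff_eq he (memLp_coeff hb hf i k)
    (memLp_of_continuousOn (hη.continuousOn_synthesis hs hβ)) fun i' k' => ?_
  rw [hη.coeff_synthesis hs hβ]
  rfl

/-- If the coefficients of almost every profile `f (u, ·)` are given by a function `G` that is
continuous with values in `ℓ²`, then `f` has a version with continuous profiles. -/
theorem exists_isContinuousVersion
    (hb : ∀ (i : ℕ) (k : Fin (levelCard m₀ i)), b ⟨i, k⟩ =ᵐ[unitMeasure] wavelet m₀ φ ψ i k)
    {f : ℝ × ℝ → ℂ} (hf : MemLp f 2 (unitMeasure.prod unitMeasure))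
    {G : ℝ → lp (fun _ : Σ i : ℕ, Fin (levelCard m₀ i) => ℂ) 2} (hG : ContinuousOn G (Icc 0 1))
    (hfG : ∀ᵐ u ∂unitMeasure, ∀ x : Σ i : ℕ, Fin (levelCard m₀ i),
      coeff m₀ φ ψ (fun t => f (u, t)) x.1 x.2 = G u x) :
    ∃ g, IsContinuousVersion f g := by
  classical
  set H : ℝ → Lp ℂ 2 unitMeasure := fun u => b.repr.symm (G u)
  have hH : ContinuousOn H (Icc 0 1) := b.repr.symm.continuous.comp_continuousOn hG
  have hgood : ∀ᵐ u ∂unitMeasure, (fun t => f (u, t)) =ᵐ[unitMeasure] H u := by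
    filter_upwards [hfG, ae_memLp_of_memLp_prod hf] with u hu hm
    refine ae_eq_of_coeff_eq hb hm (Lp.memLp _) fun i k => ?_
    rw [hu ⟨i, k⟩, coeff_eq_repr hb, LinearIsometryEquiv.apply_symm_apply]
  -- Arbitrary representatives of `H u` need not be jointly measurable in `(u, t)`. Keeping the
  -- slice of `f` whenever it already represents `H u` makes `g = f` on almost every slice in full.
  set g : ℝ × ℝ → ℂ := fun z =>
    if (fun t => f (z.1, t)) =ᵐ[unitMeasure] H z.1 then f z else H z.1 z.2
  have hg : ∀ u, (fun t => g (u, t)) =ᵐ[unitMeasure] H u := fun u => by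
    by_cases hu : (fun t => f (u, t)) =ᵐ[unitMeasure] H u
    · simpa only [g, if_pos hu] using hu
    · simp only [g, if_neg hu]
      exact EventuallyEq.rfl
  refine ⟨g, ?_, fun u _ => (memLp_congr_ae (hg u)).2 (Lp.memLp _), fun u₀ hu₀ => ?_⟩
  · have := Measure.quasiMeasurePreserving_fst (μ := unitMeasure) (ν := unitMeasure) |>.ae hgood
    filter_upwards [this] with z hz
    simp only [g, if_pos hz]
  · have hlim : Tendsto (fun u => edist (H u) (H u₀)) (𝓝[Icc (0 : ℝ) 1] u₀) (𝓝 0) :=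
      tendsto_iff_edist_tendsto_0.1 (hH u₀ hu₀)
    refine hlim.congr fun u => ?_
    rw [Lp.edist_def]
    refine eLpNorm_congr_ae ?_
    filter_upwards [hg u, hg u₀] with t h1 h2
    rw [h1, h2, Pi.sub_apply]

theorem IsContinuousVersion.continuousOn_coeff
    (hb : ∀ (i : ℕ) (k : Fin (levelCard m₀ i)), b ⟨i, k⟩ =ᵐ[unitMeasure] wavelet m₀ φ ψ i k)
    {f g : ℝ × ℝ → ℂ} (hg : IsContinuousVersion f g) (i : ℕ) (k : Fin (levelCard m₀ i)) :
    ContinuousOn (fun u => coeff m₀ φ ψ (fun t => g (u, t)) i k) (Icc 0 1) := by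
  intro u₀ hu₀
  refine tendsto_iff_edist_tendsto_0.2 ?_
  refine tendsto_of_tendsto_of_tendsto_of_le_of_le' tendsto_const_nhds (hg.continuous u₀ hu₀)
    (Eventually.of_forall fun _ => zero_le) ?_
  filter_upwards [self_mem_nhdsWithin] with u hu
  rw [edist_eq_enorm_sub, ← coeff_sub hb (hg.memLp u hu) (hg.memLp u₀ hu₀)]
  exact enorm_coeff_le hb ((hg.memLp u hu).sub (hg.memLp u₀ hu₀)) i k

/-- The coefficients of the profiles of a continuous version are determined everywhere by their
values at almost every `u`. -/
theorem IsContinuousVersion.coeff_eq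
    (hb : ∀ (i : ℕ) (k : Fin (levelCard m₀ i)), b ⟨i, k⟩ =ᵐ[unitMeasure] wavelet m₀ φ ψ i k)
    {f g : ℝ × ℝ → ℂ} (hg : IsContinuousVersion f g) (i : ℕ) (k : Fin (levelCard m₀ i))
    {γ : ℝ → ℂ} (hγ : ContinuousOn γ (Icc 0 1))
    (hfγ : ∀ᵐ u ∂unitMeasure, coeff m₀ φ ψ (fun t => f (u, t)) i k = γ u) :
    ∀ u ∈ Icc (0 : ℝ) 1, coeff m₀ φ ψ (fun t => g (u, t)) i k = γ u := by
  -- Two continuous functions on `[0,1]` that agree almost everywhere agree everywhere.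
  refine Measure.eqOn_Icc_of_ae_eq volume zero_ne_one ?_ (hg.continuousOn_coeff hb i k) hγ
  filter_upwards [hfγ, Measure.ae_ae_of_ae_prod hg.ae_eq] with u h1 h2
  rw [← h1]
  exact coeff_congr_ae h2 i k

end version

end MixedBesov

end

theorem mainTheorem6 (s₀ m₀ m₀' : ℕ) (φ ψ ξ η : ℝ → ℂ)
    (hψ : IsBandLimitedWaveletBasis m₀ φ ψ)
    (hη : IsFinitelySupportedWaveletBasis s₀ m₀' ξ η)
    (p q : ℝ≥0∞) (hp : 1 ≤ p) (hq : 1 ≤ q) (s₁ s₂ : ℝ)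
    (hs₁ : max (p⁻¹).toReal (1 / 2) ≤ s₁) (hs₂ : max (p⁻¹).toReal (1 / 2) < s₂) :
    ∃ C : ℝ, 0 < C ∧ ∀ A : ℝ, 0 < A →
      ∀ f ∈ ball₂ m₀ m₀' φ ψ ξ η s₁ s₂ p q A,
        (∃ g, IsContinuousVersion f g) ∧
        ∀ g, IsContinuousVersion f g → ∀ M l : ℕ, 1 ≤ l → l ≤ M →
          (fun t => g ((l : ℝ) / M, t)) ∈ ball m₀ φ ψ s₁ p q (C * A) := by
  obtain ⟨b, hb⟩ := hψ.basis
  obtain ⟨C₂, hC₂, hsq⟩ := exists_tsum_sq_le m₀ m₀' hp hq s₂ hs₁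
  obtain ⟨C, hC, hbound⟩ := hη.exists_lNorm_synthesis_le m₀ hp hq s₁ hs₂
  refine ⟨C, hC, fun A hA f ⟨hf, hnorm⟩ => ?_⟩
  set β : ℕ → ℕ → ℕ → ℕ → ℂ := coeff₂ m₀ m₀' φ ψ ξ η f
  have hs := half_lt_sStar hs₂
  -- `B i' k'` collects the coefficients with second index `(i', k')` into one vector of `ℓ²`.
  choose B hBeq hB using fun (i' : ℕ) (k' : Fin (levelCard m₀' i')) =>
    exists_lp_of_tsum_sq_le (by positivity) (hsq A hA β hnorm i' k')
  have hβ : ∀ x : Σ i : ℕ, Fin (levelCard m₀ i), ∀ (i' : ℕ) (k' : Fin (levelCard m₀' i')),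
      ‖β x.1 x.2 i' k'‖ ≤ C₂ * A * 2 ^ (level m₀' i' * -sStar s₂ p) := fun x i' k' => by
    rw [← hBeq i' k' x]
    exact (lp.norm_apply_le_norm (by simp) _ x).trans (hB i' k')
  have hae : ∀ x : Σ i : ℕ, Fin (levelCard m₀ i), ∀ᵐ u ∂unitMeasure,
      coeff m₀ φ ψ (fun t => f (u, t)) x.1 x.2 =
        synthesis m₀' ξ η (fun i' k' => β x.1 x.2 i' k') u :=
    fun x => ae_coeff_eq_synthesis hb hη hs hf x.1 x.2 (hβ x)
  have hcoord : ∀ x : Σ i : ℕ, Fin (levelCard m₀ i), ∀ u ∈ Icc (0 : ℝ) 1,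
      synthesis m₀' ξ η B u x = synthesis m₀' ξ η (fun i' k' => β x.1 x.2 i' k') u :=
    fun x u hu => by
      have := hη.map_synthesis hs hB
        (lp.evalCLM ℂ (fun _ : Σ i : ℕ, Fin (levelCard m₀ i) => ℂ) 2 x) hu
      simp_rw [← hBeq _ _ x]
      exact this
  refine ⟨exists_isContinuousVersion hb hf (hη.continuousOn_synthesis hs hB) ?_, ?_⟩
  · filter_upwards [ae_all_iff.2 hae, ae_restrict_mem measurableSet_Icc] with u hu hmem x
    rw [hu x, hcoord x u hmem]
  · intro g hg M l hl hlM
    have hM : (0 : ℝ) < M := by exact_mod_cast hl.trans hlM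
    have hu : (l : ℝ) / M ∈ Icc (0 : ℝ) 1 :=
      ⟨by positivity, (div_le_one hM).2 (by exact_mod_cast hlM)⟩
    refine ⟨hg.memLp _ hu, ?_⟩
    have hcoeff : ∀ (i : ℕ) (k : Fin (levelCard m₀ i)),
        coeff m₀ φ ψ (fun t => g ((l : ℝ) / M, t)) i k =
          synthesis m₀' ξ η (fun i' k' => β i k i' k') ((l : ℝ) / M) := fun i k =>
      hg.coeff_eq hb i k (hη.continuousOn_synthesis hs (hβ ⟨i, k⟩)) (hae ⟨i, k⟩) _ hu
    simp_rw [hcoeff]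
    exact hbound A hA β hnorm _ hu
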